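/- Let $d\in\mathbb N$, $s>0$, $T>0$, and consider the Cauchy problem $$u_{tt}+(-\Delta)^su+m(x)u+b(x)u_t=f(t,x)\ \text{ on }[0,T]\times\mathbb R^d,\qquad u(0,\cdot)=u_0,\quad u_t(0,\cdot)=u_1, \tag{P}$$ where $m,b$ are real distributions on $\mathbb R^d$, $u_0,u_1$ are complex distributions on $\mathbb R^d$, and $f(t,\cdot)$ is a complex distribution on $\mathbb R^d$ for every $t\in[0,T]$. **Conventions.** $(-\Delta)^a$ is the Fourier multiplier with symbol $|\xi|^{2a}$ (unitary normalisation in angular frequency $\xi$), $H^s=\{v\in L^2(\mathbb R^d):(-\Delta)^{s/2}v\in L^2(\mathbb R^d)\}$ and $\|v\|_{H^s}=\|v\|_{L^2}+\|(-\Delta)^{s/2}v\|_{L^2}$. A *regularisation* of a distribution $V$ is a net $V_\varepsilon=V*\psi_\varepsilon$, $\varepsilon\in(0,1]$, where $\psi_\varepsilon(x)=\varepsilon^{-d}\psi(\varepsilon^{-1}x)$ for some $\psi\in C_c^\infty(\mathbb R^d)$ with $\psi\ge0$ and $\int\psi=1$; for $f$ the convolution is in $x$, with the same $\psi$ for all $t$.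 Different mollifiers may be used for $m,b,f,u_0,u_1$. For a normed space $X$, a net is *$X$-moderate* if its members lie in $X$ and there are $N\in\mathbb N^*$ and $C>0$ with $\|v_\varepsilon\|_X\le C\varepsilon^{-N}$ for all $\varepsilon\in(0,1]$. For the source, *$L^2$-moderate* means $f_\varepsilon\in C([0,T];L^2(\mathbb R^d))$ and $\sup_{t\in[0,T]}\|f_\varepsilon(t,\cdot)\|_{L^2}\le C\varepsilon^{-N}$. A net $(u_\varepsilon)$ in $C([0,T];H^s)\cap C^1([0,T];L^2)$ is *$C_1$-moderate* if, for some such $N$ and $C$ and all $\varepsilon\in(0,1]$, $$\sup_{t\in[0,T]}\big(\|u_\varepsilon(t)\|_{L^2}+\|(-\Delta)^{s/2}u_\varepsilon(t)\|_{L^2}+\|\partial_tu_\varepsilon(t)\|_{L^2}\big)\le C\varepsilon^{-N}.$$ Regularisations $(m_\varepsilon),(b_\varepsilon),(f_\varepsilon),(u_{0,\varepsilon}),(u_{1,\varepsilon})$ of $m,b,f,u_0,u_1$ are *admissible* if they are $L^\infty$-, $L^\infty$-, $L^2$-, $H^s$- and $L^2$-moderate, respectively, and $m_\varepsilon\ge0$,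 $b_\varepsilon\ge0$ for all $\varepsilon\in(0,1]$. A *very weak solution* of (P) is a $C_1$-moderate net $(u_\varepsilon)_{\varepsilon\in(0,1]}$ in $C([0,T];H^s)\cap C^1([0,T];L^2)$ for which there are admissible regularisations of $m,b,f,u_0,u_1$ such that, for every $\varepsilon\in(0,1]$, $u_\varepsilon$ solves the problem (P) with $m,b,f,u_0,u_1$ replaced by $m_\varepsilon,b_\varepsilon,f_\varepsilon,u_{0,\varepsilon},u_{1,\varepsilon}$: the initial conditions hold in $L^2$, and the equation holds in $H^{-s}$ for every $t\in[0,T]$, that is, for every $\varphi\in H^s$ and $t\in[0,T]$ (one-sided derivatives at $0$ and $T$), $$\frac{d}{dt}\langle\varphi,\partial_tu_\varepsilon\rangle_{L^2}+\langle(-\Delta)^{s/2}\varphi,(-\Delta)^{s/2}u_\varepsilon\rangle_{L^2}+\langle\varphi,m_\varepsilon u_\varepsilon+b_\varepsilon\partial_tu_\varepsilon\rangle_{L^2}=\langle\varphi,f_\varepsilon\rangle_{L^2}.$$ **Theorem.** If $m,b,f,u_0,u_1$ have admissible regularisations, then the Cauchy problem (P) has a very weak solution. -/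

import Mathlib

open MeasureTheory Set TopologicalSpace
open scoped FourierTransform Distributions ENNReal ContDiff ComplexConjugate

noncomputable section

namespace VeryWeak

/-- The Euclidean space `ℝ^d`. -/
abbrev Sp (d : ℕ) : Type := EuclideanSpace ℝ (Fin d)

/-- The Hilbert space `L²(ℝ^d)` of complex-valued functions. -/
abbrev L2 (d : ℕ) : Type := Lp (α := Sp d) ℂ 2 volume

variable {d : ℕ}

/-! ### Fractional Laplacian and Sobolev spaces -/

/-- The symbol of `(-Δ)^a`. The Fourier transform of Mathlib is
`𝓕 f ξ = ∫ exp (-2πi ⟨x, ξ⟩) f x dx`, so the symbol of `-Δ` is `(2π|ξ|)²`. -/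
def fracSymbol (a : ℝ) (ξ : Sp d) : ℝ := (2 * Real.pi * ‖ξ‖) ^ (2 * a)

/-- `f ∈ L²` lies in the `L²`-domain of `(-Δ)^a`. -/
def MemFracLapDomain (a : ℝ) (f : L2 d) : Prop :=
  MemLp (fun ξ : Sp d => (fracSymbol a ξ : ℂ) * (𝓕 f : L2 d) ξ) 2 volume

open Classical in
/-- The fractional Laplacian `(-Δ)^a f = 𝓕⁻¹ (|ξ|^{2a} 𝓕 f)` (for `f` in its `L²`-domain; the
value is `0` elsewhere). -/
def fracLap (a : ℝ) (f : L2 d) : L2 d :=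
  𝓕⁻ (if h : MemFracLapDomain a f then MemLp.toLp _ h else (0 : L2 d))

/-- `f ∈ H^s(ℝ^d)`, i.e. `f ∈ L²` and `(-Δ)^{s/2} f ∈ L²`. -/
def MemHs (s : ℝ) (f : L2 d) : Prop := MemFracLapDomain (s / 2) f

/-- The norm `‖f‖_{L²} + ‖(-Δ)^{s/2} f‖_{L²}` of `H^s(ℝ^d)`. -/
def hsNorm (s : ℝ) (f : L2 d) : ℝ := ‖f‖ + ‖fracLap (s / 2) f‖

/-! ### Regularisation of distributions by convolution -/

/-- `ψ` is a (Friedrichs) mollifier: smooth, compactly supported, non-negative, of integral one. -/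
def IsMollifier (ψ : 𝓓((⊤ : Opens (Sp d)), ℝ)) : Prop :=
  (∀ x, 0 ≤ ψ x) ∧ ∫ x, ψ x = 1

/-- The test function `y ↦ ψ_ε (x - y)`, where `ψ_ε(z) = ε^{-d} ψ(ε^{-1} z)`. -/
def mollifierAt (ψ : 𝓓((⊤ : Opens (Sp d)), ℝ)) {ε : ℝ} (hε : 0 < ε) (x : Sp d) :
    𝓓((⊤ : Opens (Sp d)), ℝ) where
  toFun := fun y => (ε ^ d)⁻¹ * ψ (ε⁻¹ • (x - y))
  contDiff' := by
    have h : ContDiff ℝ ((⊤ : ℕ∞) : WithTop ℕ∞) ψ := ψ.contDiff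
    have h' : ContDiff ℝ ((⊤ : ℕ∞) : WithTop ℕ∞) (fun y : Sp d => ε⁻¹ • (x - y)) := by
      fun_prop
    exact contDiff_const.mul (h.comp h')
  hasCompactSupport' := by
    have h := ψ.hasCompactSupport.comp_homeomorph
      ((Homeomorph.subLeft x).trans (Homeomorph.smulOfNeZero ε⁻¹ (inv_ne_zero hε.ne')))
    exact h.mul_left
  tsupport_subset' := fun _ _ => trivial

/-- The net `(v_ε)`, `0 < ε ≤ 1`, of functions is the regularisation `v_ε = V * ψ_ε` of the
distribution `V` for some mollifier `ψ`. -/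
def IsRegularisation {F : Type} [NormedAddCommGroup F] [NormedSpace ℝ F]
    (V : 𝓓'((⊤ : Opens (Sp d)), F)) (v : ℝ → Sp d → F) : Prop :=
  ∃ ψ : 𝓓((⊤ : Opens (Sp d)), ℝ), IsMollifier ψ ∧
    ∀ (ε : ℝ) (hε : 0 < ε), ε ≤ 1 → ∀ x, v ε x = V (mollifierAt ψ hε x)

/-- The same for a time-dependent distribution, with `f_ε(t, ·) = f(t, ·) * ψ_ε` for
`t ∈ [0,T]`. -/
def IsTimeRegularisation (T : ℝ) (V : ℝ → 𝓓'((⊤ : Opens (Sp d)), ℂ))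
    (v : ℝ → ℝ → Sp d → ℂ) : Prop :=
  ∃ ψ : 𝓓((⊤ : Opens (Sp d)), ℝ), IsMollifier ψ ∧
    ∀ (ε : ℝ) (hε : 0 < ε), ε ≤ 1 → ∀ t ∈ Icc 0 T, ∀ x, v ε t x = V t (mollifierAt ψ hε x)

/-! ### Moderate nets -/

/-- `L^p`-moderateness: `‖v_ε‖_{L^p} ≤ C ε^{-N}` for `0 < ε ≤ 1`. -/
def LpModerate {F : Type} [NormedAddCommGroup F] (p : ℝ≥0∞) (v : ℝ → Sp d → F) : Prop :=
  ∃ N : ℕ, 0 < N ∧ ∃ C : ℝ, 0 < C ∧ ∀ ε ∈ Ioc (0 : ℝ) 1,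
    MemLp (v ε) p volume ∧ eLpNorm (v ε) p volume ≤ ENNReal.ofReal (C / ε ^ N)

/-- `H^s`-moderateness: `‖v_ε‖_{H^s} ≤ C ε^{-N}` for `0 < ε ≤ 1`. -/
def HsModerate (s : ℝ) (v : ℝ → Sp d → ℂ) : Prop :=
  ∃ N : ℕ, 0 < N ∧ ∃ C : ℝ, 0 < C ∧ ∀ ε ∈ Ioc (0 : ℝ) 1,
    ∃ w : L2 d, w =ᵐ[volume] v ε ∧ MemHs s w ∧ hsNorm s w ≤ C / ε ^ N

/-- `L²`-moderateness of a net of source terms: each `f_ε` is in `C([0,T]; L²)`, and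
`‖f_ε(t, ·)‖_{L²} ≤ C ε^{-N}` for `0 < ε ≤ 1`, uniformly in `t ∈ [0,T]`. -/
def SourceModerate (T : ℝ) (f : ℝ → ℝ → Sp d → ℂ) : Prop :=
  ∃ N : ℕ, 0 < N ∧ ∃ C : ℝ, 0 < C ∧ ∀ ε ∈ Ioc (0 : ℝ) 1,
    ∃ F : ℝ → L2 d, ContinuousOn F (Icc 0 T) ∧
      ∀ t ∈ Icc 0 T, F t =ᵐ[volume] f ε t ∧ ‖F t‖ ≤ C / ε ^ N

/-- The time derivative on `[0,T]` of a function with values in `L²` (one-sided at the ends). -/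
def dt (T : ℝ) (u : ℝ → L2 d) (t : ℝ) : L2 d := derivWithin u (Icc 0 T) t

/-- `u ∈ C([0,T]; H^s) ∩ C¹([0,T]; L²)`. -/
def MemC1 (T s : ℝ) (u : ℝ → L2 d) : Prop :=
  (∀ t ∈ Icc 0 T, MemHs s (u t)) ∧
  ContinuousOn (fun t => fracLap (s / 2) (u t)) (Icc 0 T) ∧
  ContDiffOn ℝ 1 u (Icc 0 T)

/-- `C₁`-moderateness: each `u_ε` is in `C([0,T]; H^s) ∩ C¹([0,T]; L²)`, and
`‖u_ε(t)‖_{L²} + ‖(-Δ)^{s/2} u_ε(t)‖_{L²} + ‖∂_t u_ε(t)‖_{L²} ≤ C ε^{-N}` for `0 < ε ≤ 1`,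
uniformly in `t ∈ [0,T]`. -/
def C1Moderate (T s : ℝ) (u : ℝ → ℝ → L2 d) : Prop :=
  (∀ ε ∈ Ioc (0 : ℝ) 1, MemC1 T s (u ε)) ∧
  ∃ N : ℕ, 0 < N ∧ ∃ C : ℝ, 0 < C ∧ ∀ ε ∈ Ioc (0 : ℝ) 1, ∀ t ∈ Icc 0 T,
    ‖u ε t‖ + ‖fracLap (s / 2) (u ε t)‖ + ‖dt T (u ε) t‖ ≤ C / ε ^ N

/-! ### The Cauchy problem and its very weak solutions -/

/-- `u ∈ C([0,T]; H^s) ∩ C¹([0,T]; L²)` solves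
`u_tt + (-Δ)^s u + m u + b u_t = f` on `[0,T] × ℝ^d`, `u(0) = u₀`, `u_t(0) = u₁`.
As `u_tt` and `(-Δ)^s u` take values in `H^{-s}`, the dual of `H^s`, the equation is tested against
every `φ ∈ H^s`, at every `t ∈ [0,T]`, where `⟨φ, (-Δ)^s u⟩ = ⟨(-Δ)^{s/2} φ, (-Δ)^{s/2} u⟩`. -/
def IsSolution (T s : ℝ) (m b : Sp d → ℝ) (f : ℝ → Sp d → ℂ) (u₀ u₁ : Sp d → ℂ)
    (u : ℝ → L2 d) : Prop :=
  MemC1 T s u ∧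
  u 0 =ᵐ[volume] u₀ ∧
  dt T u 0 =ᵐ[volume] u₁ ∧
  ∀ φ : L2 d, MemHs s φ → ∀ t ∈ Icc 0 T,
    HasDerivWithinAt (fun τ => inner ℂ φ (dt T u τ))
      ((∫ x, conj (φ x) * (f t x - (m x : ℂ) * u t x - (b x : ℂ) * dt T u t x))
        - inner ℂ (fracLap (s / 2) φ) (fracLap (s / 2) (u t)))
      (Icc 0 T) t

/-- The nets are regularisations of `m, b, f, u₀, u₁` that are `L^∞`-, `L^∞`-, `L²`-, `H^s`- and
`L²`-moderate respectively, with `m_ε ≥ 0` and `b_ε ≥ 0`. -/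
def AdmissibleRegularisation (T s : ℝ)
    (m b : 𝓓'((⊤ : Opens (Sp d)), ℝ)) (f : ℝ → 𝓓'((⊤ : Opens (Sp d)), ℂ))
    (u₀ u₁ : 𝓓'((⊤ : Opens (Sp d)), ℂ))
    (mε bε : ℝ → Sp d → ℝ) (fε : ℝ → ℝ → Sp d → ℂ) (u₀ε u₁ε : ℝ → Sp d → ℂ) : Prop :=
  (IsRegularisation m mε ∧ LpModerate (⊤ : ℝ≥0∞) mε ∧ ∀ ε ∈ Ioc (0 : ℝ) 1, ∀ x, 0 ≤ mε ε x) ∧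
  (IsRegularisation b bε ∧ LpModerate (⊤ : ℝ≥0∞) bε ∧ ∀ ε ∈ Ioc (0 : ℝ) 1, ∀ x, 0 ≤ bε ε x) ∧
  (IsTimeRegularisation T f fε ∧ SourceModerate T fε) ∧
  (IsRegularisation u₀ u₀ε ∧ HsModerate s u₀ε) ∧
  (IsRegularisation u₁ u₁ε ∧ LpModerate 2 u₁ε)

/-- The net `(u_ε)` is a very weak solution of `u_tt + (-Δ)^s u + m u + b u_t = f`, `u(0) = u₀`,
`u_t(0) = u₁`: it is `C₁`-moderate, and solves the Cauchy problems whose coefficients and data are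
some admissible regularisations of `m, b, f, u₀, u₁`. -/
def IsVeryWeakSolution (T s : ℝ)
    (m b : 𝓓'((⊤ : Opens (Sp d)), ℝ)) (f : ℝ → 𝓓'((⊤ : Opens (Sp d)), ℂ))
    (u₀ u₁ : 𝓓'((⊤ : Opens (Sp d)), ℂ)) (u : ℝ → ℝ → L2 d) : Prop :=
  ∃ (mε bε : ℝ → Sp d → ℝ) (fε : ℝ → ℝ → Sp d → ℂ) (u₀ε u₁ε : ℝ → Sp d → ℂ),
    AdmissibleRegularisation T s m b f u₀ u₁ mε bε fε u₀ε u₁ε ∧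
    (∀ ε ∈ Ioc (0 : ℝ) 1, IsSolution T s (mε ε) (bε ε) (fε ε) (u₀ε ε) (u₁ε ε) (u ε)) ∧
    C1Moderate T s u

end VeryWeak

end

/-!
# Existence of very weak solutions of a damped fractional wave equation

For each `ε` the regularised coefficients `m`, `b` are bounded and non-negative, so it suffices to
solve the Cauchy problem for bounded coefficients with an estimate that is polynomial in the norms
of the coefficients and data (`VeryWeak.exists_isSolution`).

Put `A = (-Δ)^{s/2}`, `M = m ·`, `B = b ·`. In terms of `w± = u' ± i A u`, the equation
`u'' + A² u + M u + B u' = F` reads `w±' = ± i A w± + g` with `g = F - M u - B u'`. In the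
interaction picture `z± = e^{∓ i t A} w±`, the unbounded operator disappears:
`z±' = e^{∓ i t A} g` and `u' = (e^{i t A} z₊ + e^{- i t A} z₋) / 2` form an ordinary differential
equation for `(z₊, z₋, u)` in a Hilbert space. Its right-hand side is globally Lipschitz and
continuous in time, hence it has a solution on `[0, T]`
(`exists_forall_hasDerivWithinAt_of_lipschitzWith`).

Let `y = (e^{i t A} z₊ - e^{- i t A} z₋) / (2i)`. Pairing with `φ` in the domain of `A`, on which
`e^{i t A} φ` is differentiable, gives `⟨φ, u'⟩' = ⟨φ, g⟩ - ⟨A φ, y⟩` and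
`⟨φ, y⟩' = ⟨A φ, u'⟩ = ⟨A φ, u⟩'`. The latter yields `⟨φ, y⟩ = ⟨A φ, u⟩`, so `u` is in the domain
of the self-adjoint operator `A` and `A u = y`; the former is then the weak form of the equation.

Since `e^{i t A}` is unitary, `2 (‖u'‖² + ‖A u‖²) = ‖z₊‖² + ‖z₋‖²`, which is differentiable although
`u'` and `A u` need not be. Therefore `E = ‖u'‖² + ‖A u‖² + ⟨u, M u⟩` satisfies
`E' = 2 Re ⟨u', F⟩ - 2 ⟨u', B u'⟩ ≤ E + ‖F‖²`, and Grönwall's inequality gives the estimate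
(`IsUnitaryGroup.exists_wave_solution`). The group `e^{i t A}` is a Fourier multiplier
(`VeryWeak.isUnitaryGroup_waveGroup`).
-/

/-! ### Global solutions of ordinary differential equations with Lipschitz right-hand side -/

section GlobalODE

variable {E : Type*} [NormedAddCommGroup E] [NormedSpace ℝ E]

/-- The radial retraction of a normed space onto the closed ball of radius `R` around `0`. -/
noncomputable def radialRetraction (R : ℝ) (x : E) : E := (R / max R ‖x‖) • x

lemma norm_radialRetraction_le_norm {R : ℝ} (hR : 0 < R) (x : E) :
    ‖radialRetraction R x‖ ≤ ‖x‖ := by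
  have hm : 0 < max R ‖x‖ := lt_max_of_lt_left hR
  rw [radialRetraction, norm_smul, Real.norm_of_nonneg (by positivity)]
  exact mul_le_of_le_one_left (norm_nonneg x) ((div_le_one hm).2 (le_max_left _ _))

lemma norm_radialRetraction_le {R : ℝ} (hR : 0 < R) (x : E) : ‖radialRetraction R x‖ ≤ R := by
  have hm : 0 < max R ‖x‖ := lt_max_of_lt_left hR
  rw [radialRetraction, norm_smul, Real.norm_of_nonneg (by positivity), div_mul_eq_mul_div,
    div_le_iff₀ hm]
  exact mul_le_mul_of_nonneg_left (le_max_right _ _) hR.le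

lemma radialRetraction_of_norm_le {R : ℝ} (hR : 0 < R) {x : E} (hx : ‖x‖ ≤ R) :
    radialRetraction R x = x := by
  rw [radialRetraction, max_eq_left hx, div_self hR.ne', one_smul]

lemma lipschitzWith_radialRetraction {R : ℝ} (hR : 0 < R) :
    LipschitzWith 2 (radialRetraction R : E → E) := by
  refine LipschitzWith.of_dist_le_mul fun x y => ?_
  rw [dist_eq_norm, dist_eq_norm]
  have hx : 0 < max R ‖x‖ := lt_max_of_lt_left hR
  have hy : 0 < max R ‖y‖ := lt_max_of_lt_left hR
  have hsplit : radialRetraction R x - radialRetraction R y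
      = (R / max R ‖x‖) • (x - y) + (R / max R ‖x‖ - R / max R ‖y‖) • y := by
    simp only [radialRetraction, smul_sub, sub_smul]; abel
  have h1 : R / max R ‖x‖ ≤ 1 := (div_le_one hx).2 (le_max_left _ _)
  have h2 : ‖y‖ / max R ‖y‖ ≤ 1 := (div_le_one hy).2 (le_max_right _ _)
  have hdiff : |max R ‖y‖ - max R ‖x‖| ≤ ‖x - y‖ := by
    refine (abs_max_sub_max_le_max _ _ _ _).trans ?_
    rw [sub_self, abs_zero, max_eq_right (abs_nonneg _), norm_sub_rev]
    exact abs_norm_sub_norm_le y x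
  have hfac : |R / max R ‖x‖ - R / max R ‖y‖| * ‖y‖
      = (R / max R ‖x‖) * (‖y‖ / max R ‖y‖) * |max R ‖y‖ - max R ‖x‖| := by
    have : R / max R ‖x‖ - R / max R ‖y‖
        = (R / (max R ‖x‖ * max R ‖y‖)) * (max R ‖y‖ - max R ‖x‖) := by
      field_simp
    rw [this, abs_mul, abs_of_nonneg (by positivity)]
    field_simp
  have hprod : (R / max R ‖x‖) * (‖y‖ / max R ‖y‖) ≤ 1 :=
    mul_le_one₀ h1 (by positivity) h2
  rw [hsplit]
  refine (norm_add_le _ _).trans ?_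
  rw [norm_smul, norm_smul, Real.norm_of_nonneg (by positivity), Real.norm_eq_abs, hfac]
  have e1 : (R / max R ‖x‖) * ‖x - y‖ ≤ ‖x - y‖ := mul_le_of_le_one_left (norm_nonneg _) h1
  have e2 := mul_le_mul hprod hdiff (abs_nonneg _) zero_le_one
  push_cast
  linarith

/-- A right-hand side that is Lipschitz on the whole space, uniformly in time, and continuous in
time admits solutions on the whole time interval. The Picard–Lindelöf theorem gives them for the
right-hand side composed with the retraction onto a large ball, as that composition is bounded;
Grönwall's inequality shows that the solution never leaves the ball. -/
theorem exists_forall_hasDerivWithinAt_of_lipschitzWith [CompleteSpace E] {f : ℝ → E → E} {T : ℝ}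
    (hT : 0 ≤ T) {K : NNReal} (hlip : ∀ t ∈ Icc 0 T, LipschitzWith K (f t))
    (hcont : ∀ x, ContinuousOn (f · x) (Icc 0 T)) (x₀ : E) :
    ∃ α : ℝ → E, α 0 = x₀ ∧ ∀ t ∈ Icc 0 T, HasDerivWithinAt α (f t (α t)) (Icc 0 T) t := by
  obtain ⟨C, hC⟩ := isCompact_Icc.exists_bound_of_continuousOn (hcont 0)
  have hC0 : 0 ≤ C := (norm_nonneg _).trans (hC 0 ⟨le_rfl, hT⟩)
  have hgrow : ∀ t ∈ Icc 0 T, ∀ x, ‖f t x‖ ≤ K * ‖x‖ + C := fun t ht x => by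
    have h1 := (hlip t ht).dist_le_mul x 0
    rw [dist_eq_norm, dist_zero_right] at h1
    have h2 := norm_le_norm_add_norm_sub' (f t x) (f t 0)
    linarith [hC t ht]
  obtain ⟨R, hR⟩ : ∃ R, R = max 1 (gronwallBound ‖x₀‖ K C T) := ⟨_, rfl⟩
  have hR0 : 0 < R := hR ▸ lt_max_of_lt_left one_pos
  set g : ℝ → E → E := fun t x => f t (radialRetraction R x)
  have hg : ∀ t ∈ Icc 0 T, ∀ x, ‖g t x‖ ≤ K * R + C := fun t ht x =>
    (hgrow t ht _).trans (by gcongr; exact norm_radialRetraction_le hR0 x)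
  have hL0 : 0 ≤ K * R + C := by positivity
  have hPL : IsPicardLindelof g (⟨0, le_rfl, hT⟩ : Icc 0 T) x₀
      (Real.toNNReal ((K * R + C) * T)) 0 (Real.toNNReal (K * R + C)) (K * 2) :=
    { lipschitzOnWith := fun t ht =>
        ((hlip t ht).comp (lipschitzWith_radialRetraction hR0)).lipschitzOnWith
      continuousOn := fun x _ => hcont _
      norm_le := fun t ht x _ => by
        rw [Real.coe_toNNReal _ hL0]; exact hg t ht x
      mul_max_le := by
        rw [Real.coe_toNNReal _ hL0, Real.coe_toNNReal _ (mul_nonneg hL0 hT)]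
        simp [hT] }
  obtain ⟨α, hα0, hα⟩ := hPL.exists_eq_forall_mem_Icc_hasDerivWithinAt₀
  refine ⟨α, hα0, fun t ht => ?_⟩
  have hbound := norm_le_gronwallBound_of_norm_deriv_right_le (δ := ‖x₀‖) (K := K) (ε := C)
    (fun t ht => (hα t ht).continuousWithinAt)
    (fun t ht => (hα t (Ico_subset_Icc_self ht)).mono_of_mem_nhdsWithin
      (Icc_mem_nhdsGE_of_mem ht)) (by simp [← hα0])
    (fun t ht => (hgrow t (Ico_subset_Icc_self ht) _).trans
      (by gcongr; exact norm_radialRetraction_le_norm hR0 _)) t ht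
  have hαR : ‖α t‖ ≤ R := by
    rw [hR]
    refine le_max_of_le_right (hbound.trans ?_)
    exact gronwallBound_mono (norm_nonneg _) hC0 K.2 (by linarith [ht.2])
  have := hα t ht
  simp only [g, radialRetraction_of_norm_le hR0 hαR] at this
  exact this

end GlobalODE

/-! ### The abstract wave equation with bounded perturbations -/

section AbstractWave

open Complex

variable {H : Type*} [NormedAddCommGroup H] [InnerProductSpace ℂ H]

/-- `U` is a strongly continuous one-parameter group of unitaries whose generator is `iA`, with `A`
self-adjoint on the domain `D`. Self-adjointness is recorded as symmetry together with the
inclusion of the domain of the adjoint in `D`. Only those consequences of the group law that the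
wave equation needs are listed. -/
structure IsUnitaryGroup [NormedSpace ℝ H] (U : ℝ → H →L[ℂ] H) (D : Set H) (A : H → H) :
    Prop where
  zero_apply : ∀ x, U 0 x = x
  apply_neg_apply : ∀ t x, U t (U (-t) x) = x
  norm_apply : ∀ t x, ‖U t x‖ = ‖x‖
  inner_apply : ∀ t x y, inner ℂ x (U t y) = inner ℂ (U (-t) x) y
  continuous : ∀ x, Continuous fun t => U t x
  hasDerivAt : ∀ φ ∈ D, ∀ t, HasDerivAt (fun τ => U τ φ) (I • U t (A φ)) t
  symm : ∀ φ ∈ D, ∀ ψ ∈ D, inner ℂ (A φ) ψ = inner ℂ φ (A ψ)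
  eq_of_inner_eq : ∀ u y, (∀ φ ∈ D, inner ℂ (A φ) u = inner ℂ φ y) → u ∈ D ∧ A u = y

namespace IsUnitaryGroup

variable [NormedSpace ℝ H] {U : ℝ → H →L[ℂ] H} {D : Set H} {A : H → H}

lemma neg_apply_apply (hU : IsUnitaryGroup U D A) (t : ℝ) (x : H) : U (-t) (U t x) = x := by
  simpa using hU.apply_neg_apply (-t) x

lemma inner_neg_apply (hU : IsUnitaryGroup U D A) (t : ℝ) (x y : H) :
    inner ℂ x (U (-t) y) = inner ℂ (U t x) y := by
  simpa using hU.inner_apply (-t) x y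

lemma continuous_uncurry (hU : IsUnitaryGroup U D A) :
    Continuous fun p : ℝ × H => U p.1 p.2 :=
  continuous_prod_of_continuous_lipschitzWith' _ 1
    (fun t => LipschitzWith.of_dist_le_mul fun x y => by
      simp [dist_eq_norm, ← map_sub, hU.norm_apply])
    hU.continuous

lemma continuousOn_apply (hU : IsUnitaryGroup U D A) {g : ℝ → H} {S : Set ℝ}
    (hg : ContinuousOn g S) : ContinuousOn (fun t => U t (g t)) S :=
  hU.continuous_uncurry.comp_continuousOn (continuousOn_id.prodMk hg)

lemma continuousOn_neg_apply (hU : IsUnitaryGroup U D A) {g : ℝ → H} {S : Set ℝ}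
    (hg : ContinuousOn g S) : ContinuousOn (fun t => U (-t) (g t)) S :=
  hU.continuous_uncurry.comp_continuousOn (continuousOn_neg.prodMk hg)

lemma hasDerivAt_neg [IsScalarTower ℝ ℂ H] (hU : IsUnitaryGroup U D A) {φ : H} (hφ : φ ∈ D)
    (t : ℝ) : HasDerivAt (fun τ => U (-τ) φ) (-(I • U (-t) (A φ))) t := by
  have := (hU.hasDerivAt φ hφ (-t)).scomp t (_root_.hasDerivAt_neg t)
  simpa [Function.comp_def] using this

/-- Weak form of the product rule for `t ↦ U(t) z(t)`, where only the test vector has to lie in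
the domain of the generator. -/
lemma hasDerivWithinAt_inner_apply [IsScalarTower ℝ ℂ H] (hU : IsUnitaryGroup U D A) {φ : H}
    (hφ : φ ∈ D) {z : ℝ → H} {z' : H} {S : Set ℝ} {t : ℝ} (hz : HasDerivWithinAt z z' S t) :
    HasDerivWithinAt (fun τ => inner ℂ φ (U τ (z τ)))
      (inner ℂ φ (U t z') + I * inner ℂ (A φ) (U t (z t))) S t := by
  have := (hU.hasDerivAt_neg hφ t).hasDerivWithinAt.inner ℂ hz
  simp only [hU.inner_apply]
  refine this.congr_deriv ?_
  rw [inner_neg_left, inner_smul_left, conj_I]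
  ring

lemma hasDerivWithinAt_inner_neg_apply [IsScalarTower ℝ ℂ H] (hU : IsUnitaryGroup U D A) {φ : H}
    (hφ : φ ∈ D) {z : ℝ → H} {z' : H} {S : Set ℝ} {t : ℝ} (hz : HasDerivWithinAt z z' S t) :
    HasDerivWithinAt (fun τ => inner ℂ φ (U (-τ) (z τ)))
      (inner ℂ φ (U (-t) z') - I * inner ℂ (A φ) (U (-t) (z t))) S t := by
  have := (hU.hasDerivAt φ hφ t).hasDerivWithinAt.inner ℂ hz
  simp only [hU.inner_neg_apply]
  refine this.congr_deriv ?_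
  rw [inner_smul_left, conj_I]
  ring

end IsUnitaryGroup

/-- The velocity `(U(t) p + U(-t) q) / 2` of the wave with the profiles `p` and `q`. -/
noncomputable def waveVelocity (U : ℝ → H →L[ℂ] H) (t : ℝ) (p q : H) : H :=
  (1 / 2 : ℂ) • (U t p + U (-t) q)

/-- The vector `A u = (U(t) p - U(-t) q) / (2i)` of the wave with the profiles `p` and `q`. -/
noncomputable def waveGradient (U : ℝ → H →L[ℂ] H) (t : ℝ) (p q : H) : H :=
  (-I / 2 : ℂ) • (U t p - U (-t) q)

lemma waveVelocity_sub (U : ℝ → H →L[ℂ] H) (t : ℝ) (p q p' q' : H) :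
    waveVelocity U t p q - waveVelocity U t p' q' = waveVelocity U t (p - p') (q - q') := by
  simp only [waveVelocity, map_sub, ← smul_sub]
  congr 1
  abel

/-- The wave equation `u'' + A² u + M u + B u' = F` as an ordinary differential equation for
`(U(-t) (u' + i A u), U(t) (u' - i A u), u)`. No unbounded operator is left on its right-hand
side. -/
noncomputable def waveField (U : ℝ → H →L[ℂ] H) (M B : H →L[ℂ] H) (F : ℝ → H) (t : ℝ)
    (x : H × H × H) : H × H × H :=
  (U (-t) (F t - M x.2.2 - B (waveVelocity U t x.1 x.2.1)),
    U t (F t - M x.2.2 - B (waveVelocity U t x.1 x.2.1)),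
    waveVelocity U t x.1 x.2.1)

section

variable [NormedSpace ℝ H] {U : ℝ → H →L[ℂ] H} {D : Set H} {A : H → H}

lemma norm_waveVelocity_le (hU : IsUnitaryGroup U D A) (t : ℝ) (p q : H) :
    ‖waveVelocity U t p q‖ ≤ max ‖p‖ ‖q‖ := by
  have h := norm_add_le (U t p) (U (-t) q)
  rw [hU.norm_apply, hU.norm_apply] at h
  rw [waveVelocity, norm_smul]
  norm_num
  have h1 := le_max_left ‖p‖ ‖q‖
  have h2 := le_max_right ‖p‖ ‖q‖
  have : ‖U t p + U (-t) q‖ ≤ 2 * max ‖p‖ ‖q‖ := by linarith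
  rcases le_max_iff.1 (le_refl (max ‖p‖ ‖q‖)) with h3 | h3
  · left; linarith
  · right; linarith

lemma continuousOn_waveVelocity (hU : IsUnitaryGroup U D A) {p q : ℝ → H} {S : Set ℝ}
    (hp : ContinuousOn p S) (hq : ContinuousOn q S) :
    ContinuousOn (fun t => waveVelocity U t (p t) (q t)) S :=
  ((hU.continuousOn_apply hp).add (hU.continuousOn_neg_apply hq)).const_smul _

lemma continuousOn_waveGradient (hU : IsUnitaryGroup U D A) {p q : ℝ → H} {S : Set ℝ}
    (hp : ContinuousOn p S) (hq : ContinuousOn q S) :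
    ContinuousOn (fun t => waveGradient U t (p t) (q t)) S :=
  ((hU.continuousOn_apply hp).sub (hU.continuousOn_neg_apply hq)).const_smul _

lemma lipschitzWith_waveField (hU : IsUnitaryGroup U D A) (M B : H →L[ℂ] H) (F : ℝ → H) (t : ℝ) :
    LipschitzWith (‖M‖₊ + ‖B‖₊ + 1) (waveField U M B F t) := by
  refine LipschitzWith.of_dist_le_mul fun x x' => ?_
  rw [dist_eq_norm, dist_eq_norm]
  have hv : ‖waveVelocity U t x.1 x.2.1 - waveVelocity U t x'.1 x'.2.1‖ ≤ ‖x - x'‖ := by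
    rw [waveVelocity_sub]
    refine (norm_waveVelocity_le hU _ _ _).trans (max_le ?_ ?_)
    · exact norm_fst_le (x - x')
    · exact (norm_fst_le (x - x').2).trans (norm_snd_le (x - x'))
  have hu : ‖x.2.2 - x'.2.2‖ ≤ ‖x - x'‖ :=
    (norm_snd_le (x - x').2).trans (norm_snd_le (x - x'))
  have hg : ‖(F t - M x.2.2 - B (waveVelocity U t x.1 x.2.1))
      - (F t - M x'.2.2 - B (waveVelocity U t x'.1 x'.2.1))‖
      ≤ (‖M‖ + ‖B‖) * ‖x - x'‖ := by
    have : (F t - M x.2.2 - B (waveVelocity U t x.1 x.2.1))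
      - (F t - M x'.2.2 - B (waveVelocity U t x'.1 x'.2.1))
      = -(M (x.2.2 - x'.2.2)
        + B (waveVelocity U t x.1 x.2.1 - waveVelocity U t x'.1 x'.2.1)) := by
      simp only [map_sub]; abel
    rw [this, norm_neg, add_mul]
    exact (norm_add_le _ _).trans
      (add_le_add (M.le_opNorm_of_le hu) (B.le_opNorm_of_le hv))
  have hn := norm_nonneg (x - x')
  have hM := norm_nonneg M
  have hB := norm_nonneg B
  have hK : ((‖M‖₊ + ‖B‖₊ + 1 : NNReal) : ℝ) = ‖M‖ + ‖B‖ + 1 := by simp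
  rw [hK]
  refine max_le ?_ (max_le ?_ ?_)
  · change ‖U (-t) _ - U (-t) _‖ ≤ _
    rw [← map_sub, hU.norm_apply]
    nlinarith
  · change ‖U t _ - U t _‖ ≤ _
    rw [← map_sub, hU.norm_apply]
    nlinarith
  · change ‖waveVelocity U t x.1 x.2.1 - waveVelocity U t x'.1 x'.2.1‖ ≤ _
    nlinarith

lemma continuousOn_waveField (hU : IsUnitaryGroup U D A) (M B : H →L[ℂ] H) {F : ℝ → H} {S : Set ℝ}
    (hF : ContinuousOn F S) (x : H × H × H) : ContinuousOn (waveField U M B F · x) S := by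
  have hv : ContinuousOn (fun t => waveVelocity U t x.1 x.2.1) S :=
    continuousOn_waveVelocity hU continuousOn_const continuousOn_const
  have hg : ContinuousOn (fun t => F t - M x.2.2 - B (waveVelocity U t x.1 x.2.1)) S :=
    (hF.sub continuousOn_const).sub (B.continuous.comp_continuousOn hv)
  exact (hU.continuousOn_neg_apply hg).prodMk ((hU.continuousOn_apply hg).prodMk hv)

lemma norm_profiles_sq (hU : IsUnitaryGroup U D A) (t : ℝ) (p q : H) :
    ‖p‖ ^ 2 + ‖q‖ ^ 2 = 2 * (‖waveVelocity U t p q‖ ^ 2 + ‖waveGradient U t p q‖ ^ 2) := by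
  have h := parallelogram_law_with_norm ℂ (U t p) (U (-t) q)
  rw [hU.norm_apply, hU.norm_apply] at h
  simp only [waveVelocity, waveGradient, norm_smul]
  norm_num
  nlinarith

/-- The balance of the energy `‖u'‖² + ‖A u‖²`. Strong differentiability of `u'` and `A u` is not
needed, since the energy is half the sum of the squared norms of the profiles. -/
lemma hasDerivWithinAt_energy (hU : IsUnitaryGroup U D A)
    {p q : ℝ → H} {g : H} {S : Set ℝ} {t : ℝ} (hp : HasDerivWithinAt p (U (-t) g) S t)
    (hq : HasDerivWithinAt q (U t g) S t) :
    HasDerivWithinAt (fun τ => ‖waveVelocity U τ (p τ) (q τ)‖ ^ 2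
        + ‖waveGradient U τ (p τ) (q τ)‖ ^ 2)
      (2 * (inner ℂ (waveVelocity U t (p t) (q t)) g).re) S t := by
  have key : ∀ τ, ‖waveVelocity U τ (p τ) (q τ)‖ ^ 2 + ‖waveGradient U τ (p τ) (q τ)‖ ^ 2
      = (1 / 2) * (Complex.reCLM (inner ℂ (p τ) (p τ) + inner ℂ (q τ) (q τ))) := fun τ => by
    have := norm_profiles_sq hU τ (p τ) (q τ)
    rw [inner_self_eq_norm_sq_to_K, inner_self_eq_norm_sq_to_K]
    have e : Complex.reCLM (((‖p τ‖ : ℝ) : ℂ) ^ 2 + ((‖q τ‖ : ℝ) : ℂ) ^ 2)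
      = ‖p τ‖ ^ 2 + ‖q τ‖ ^ 2 := by
      rw [← Complex.ofReal_pow, ← Complex.ofReal_pow, ← Complex.ofReal_add]
      exact Complex.ofReal_re _
    erw [e]
    linarith
  simp only [key]
  have h := (Complex.reCLM.hasFDerivAt.comp_hasDerivWithinAt t
    ((hp.inner ℂ hp).add (hq.inner ℂ hq))).const_mul (1 / 2 : ℝ)
  refine h.congr_deriv ?_
  rw [hU.inner_neg_apply, hU.inner_apply]
  have c1 : (inner ℂ (U (-t) g) (p t) : ℂ).re = (inner ℂ (U t (p t)) g).re := by
    rw [← hU.inner_apply, ← inner_conj_symm, Complex.conj_re]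
  have c2 : (inner ℂ (U t g) (q t) : ℂ).re = (inner ℂ (U (-t) (q t)) g).re := by
    rw [← hU.inner_neg_apply, ← inner_conj_symm, Complex.conj_re]
  have c3 : (inner ℂ (waveVelocity U t (p t) (q t)) g : ℂ)
      = (1 / 2 : ℂ) * (inner ℂ (U t (p t)) g + inner ℂ (U (-t) (q t)) g) := by
    rw [waveVelocity, inner_smul_left, inner_add_left,
      show (1 / 2 : ℂ) = ((1 / 2 : ℝ) : ℂ) by norm_num, conj_ofReal]
  have c4 : ((1 / 2 : ℂ) * (inner ℂ (U t (p t)) g + inner ℂ (U (-t) (q t)) g)).re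
      = 1 / 2 * ((inner ℂ (U t (p t)) g).re + (inner ℂ (U (-t) (q t)) g).re) := by
    norm_num
  rw [c3, c4]
  simp only [Complex.reCLM_apply, Complex.add_re, c1, c2]
  ring

variable [IsScalarTower ℝ ℂ H]

lemma hasDerivWithinAt_inner_waveVelocity (hU : IsUnitaryGroup U D A) {φ : H} (hφ : φ ∈ D)
    {p q : ℝ → H} {g : H} {S : Set ℝ} {t : ℝ} (hp : HasDerivWithinAt p (U (-t) g) S t)
    (hq : HasDerivWithinAt q (U t g) S t) :
    HasDerivWithinAt (fun τ => inner ℂ φ (waveVelocity U τ (p τ) (q τ)))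
      (inner ℂ φ g - inner ℂ (A φ) (waveGradient U t (p t) (q t))) S t := by
  have h := ((hU.hasDerivWithinAt_inner_apply hφ hp).add
    (hU.hasDerivWithinAt_inner_neg_apply hφ hq)).const_mul (1 / 2 : ℂ)
  rw [hU.apply_neg_apply, hU.neg_apply_apply] at h
  simp only [waveVelocity, waveGradient, inner_smul_right, inner_add_right, inner_sub_right]
  refine h.congr_deriv ?_
  ring

lemma hasDerivWithinAt_inner_waveGradient (hU : IsUnitaryGroup U D A) {φ : H} (hφ : φ ∈ D)
    {p q : ℝ → H} {g : H} {S : Set ℝ} {t : ℝ} (hp : HasDerivWithinAt p (U (-t) g) S t)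
    (hq : HasDerivWithinAt q (U t g) S t) :
    HasDerivWithinAt (fun τ => inner ℂ φ (waveGradient U τ (p τ) (q τ)))
      (inner ℂ (A φ) (waveVelocity U t (p t) (q t))) S t := by
  have h := ((hU.hasDerivWithinAt_inner_apply hφ hp).sub
    (hU.hasDerivWithinAt_inner_neg_apply hφ hq)).const_mul (-I / 2 : ℂ)
  rw [hU.apply_neg_apply, hU.neg_apply_apply] at h
  simp only [waveVelocity, waveGradient, inner_smul_right, inner_add_right, inner_sub_right]
  refine h.congr_deriv ?_
  linear_combination (-1 / 2 * inner ℂ (A φ) (U t (p t)) - 1 / 2 * inner ℂ (A φ) (U (-t) (q t)))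
    * I_mul_I

/-- Grönwall's inequality for `y' ≤ y + k`. -/
lemma le_exp_mul_of_deriv_le {y y' : ℝ → ℝ} {T k : ℝ} (hk : 0 ≤ k) (hy0 : 0 ≤ y 0)
    (hy : ∀ t ∈ Icc 0 T, HasDerivWithinAt y (y' t) (Icc 0 T) t)
    (hle : ∀ t ∈ Icc 0 T, y' t ≤ y t + k) {t : ℝ} (ht : t ∈ Icc 0 T) :
    y t ≤ Real.exp T * (y 0 + k) := by
  have h := le_gronwallBound_of_liminf_deriv_right_le (f := y) (f' := y') (δ := y 0) (K := 1)
    (ε := k) (a := 0) (b := T) (fun t ht => (hy t ht).continuousWithinAt)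
    (fun t ht r hr => ((hy t (Ico_subset_Icc_self ht)).mono_of_mem_nhdsWithin
      (Icc_mem_nhdsGE_of_mem ht)).liminf_right_slope_le hr) le_rfl
    (fun t ht => by simpa using hle t (Ico_subset_Icc_self ht)) t ht
  rw [gronwallBound_of_K_ne_0 one_ne_zero] at h
  simp only [one_mul, div_one, sub_zero] at h
  have h1 : Real.exp t ≤ Real.exp T := Real.exp_le_exp.2 ht.2
  nlinarith

/-- Well-posedness of `u'' + A² u + M u + B u' = F` with bounded `M ≥ 0` and `B ≥ 0`, where `v`
stands for `u'`. The energy bound does not involve the norm of `B`, and `M` enters it only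
through the initial potential energy. -/
theorem IsUnitaryGroup.exists_wave_solution [CompleteSpace H] (hU : IsUnitaryGroup U D A)
    (M B : H →L[ℂ] H)
    (hMsymm : ∀ x y, inner ℂ (M x) y = inner ℂ x (M y))
    (hM : ∀ x, 0 ≤ (inner ℂ x (M x)).re) (hB : ∀ x, 0 ≤ (inner ℂ x (B x)).re)
    {F : ℝ → H} {T c : ℝ} (hT : 0 ≤ T) (hF : ContinuousOn F (Icc 0 T))
    (hc : ∀ t ∈ Icc 0 T, ‖F t‖ ≤ c) {u₀ : H} (hu₀ : u₀ ∈ D) (u₁ : H) :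
    ∃ u v : ℝ → H, u 0 = u₀ ∧ v 0 = u₁ ∧
      (∀ t ∈ Icc 0 T, HasDerivWithinAt u (v t) (Icc 0 T) t) ∧
      ContinuousOn v (Icc 0 T) ∧
      (∀ t ∈ Icc 0 T, u t ∈ D) ∧
      ContinuousOn (fun t => A (u t)) (Icc 0 T) ∧
      (∀ φ ∈ D, ∀ t ∈ Icc 0 T, HasDerivWithinAt (fun τ => inner ℂ φ (v τ))
        (inner ℂ φ (F t - M (u t) - B (v t)) - inner ℂ (A φ) (A (u t))) (Icc 0 T) t) ∧
      ∀ t ∈ Icc 0 T, ‖v t‖ ^ 2 + ‖A (u t)‖ ^ 2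
        ≤ Real.exp T * (‖u₁‖ ^ 2 + ‖A u₀‖ ^ 2 + ‖M‖ * ‖u₀‖ ^ 2 + c ^ 2) := by
  have h0 : (0 : ℝ) ∈ Icc 0 T := ⟨le_rfl, hT⟩
  obtain ⟨α, hα0, hα⟩ := exists_forall_hasDerivWithinAt_of_lipschitzWith hT
    (fun t _ => lipschitzWith_waveField hU M B F t) (continuousOn_waveField hU M B hF)
    (u₁ + I • A u₀, u₁ - I • A u₀, u₀)
  set p : ℝ → H := fun t => (α t).1
  set q : ℝ → H := fun t => (α t).2.1
  set u : ℝ → H := fun t => (α t).2.2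
  set v : ℝ → H := fun t => waveVelocity U t (p t) (q t)
  set y : ℝ → H := fun t => waveGradient U t (p t) (q t)
  set g : ℝ → H := fun t => F t - M (u t) - B (v t)
  have hp : ∀ t ∈ Icc 0 T, HasDerivWithinAt p (U (-t) (g t)) (Icc 0 T) t := fun t ht =>
    (hα t ht).fst
  have hq : ∀ t ∈ Icc 0 T, HasDerivWithinAt q (U t (g t)) (Icc 0 T) t := fun t ht =>
    (hα t ht).snd.fst
  have hu : ∀ t ∈ Icc 0 T, HasDerivWithinAt u (v t) (Icc 0 T) t := fun t ht =>
    (hα t ht).snd.snd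
  have hpc : ContinuousOn p (Icc 0 T) := fun t ht => (hp t ht).continuousWithinAt
  have hqc : ContinuousOn q (Icc 0 T) := fun t ht => (hq t ht).continuousWithinAt
  have hvc : ContinuousOn v (Icc 0 T) := continuousOn_waveVelocity hU hpc hqc
  have hyc : ContinuousOn y (Icc 0 T) := continuousOn_waveGradient hU hpc hqc
  have hu0 : u 0 = u₀ := by simp [u, hα0]
  have hv0 : v 0 = u₁ := by
    simp only [v, p, q, hα0, waveVelocity, neg_zero, hU.zero_apply]
    rw [add_add_sub_cancel, ← two_smul ℂ u₁, smul_smul]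
    norm_num
  have hy0 : y 0 = A u₀ := by
    simp only [y, p, q, hα0, waveGradient, neg_zero, hU.zero_apply]
    rw [add_sub_sub_cancel, ← two_smul ℂ (I • A u₀), smul_smul, smul_smul]
    have : -I / 2 * 2 * I = 1 := by linear_combination -I_mul_I
    rw [this, one_smul]
  -- `⟨Aφ, u⟩` and `⟨φ, y⟩` have the same derivative and the same initial value, so `y = Au`.
  have hweak : ∀ t ∈ Icc 0 T, ∀ φ ∈ D, inner ℂ (A φ) (u t) = inner ℂ φ (y t) := by
    intro t ht φ hφ
    have hd : ∀ τ ∈ Icc 0 T, HasDerivWithinAt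
        (fun τ => inner ℂ (A φ) (u τ) - inner ℂ φ (y τ)) 0 (Icc 0 T) τ := fun τ hτ => by
      have h1 := (hasDerivWithinAt_const τ (Icc 0 T) (A φ)).inner ℂ (hu τ hτ)
      have h2 := hasDerivWithinAt_inner_waveGradient hU hφ (hp τ hτ) (hq τ hτ)
      refine (h1.sub h2).congr_deriv ?_
      simp [v]
    have := norm_image_sub_le_of_norm_deriv_le_segment' hd (C := 0) (by simp) t ht
    rw [zero_mul, norm_le_zero_iff, sub_eq_zero, hu0, hy0, hU.symm φ hφ u₀ hu₀, sub_self,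
      sub_eq_zero] at this
    exact this
  have huD : ∀ t ∈ Icc 0 T, u t ∈ D ∧ A (u t) = y t := fun t ht =>
    hU.eq_of_inner_eq _ _ (hweak t ht)
  refine ⟨u, v, hu0, hv0, hu, hvc, fun t ht => (huD t ht).1,
    hyc.congr fun t ht => (huD t ht).2, fun φ hφ t ht => ?_, fun t ht => ?_⟩
  · rw [(huD t ht).2]
    exact hasDerivWithinAt_inner_waveVelocity hU hφ (hp t ht) (hq t ht)
  · rw [(huD t ht).2]
    have hpot : ∀ τ ∈ Icc 0 T, HasDerivWithinAt (fun τ => (inner ℂ (u τ) (M (u τ)) : ℂ).re)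
        (2 * (inner ℂ (v τ) (M (u τ)) : ℂ).re) (Icc 0 T) τ := fun τ hτ => by
      have hMu : HasDerivWithinAt (fun τ => M (u τ)) (M (v τ)) (Icc 0 T) τ :=
        (M.restrictScalars ℝ).hasFDerivAt.comp_hasDerivWithinAt τ (hu τ hτ)
      have h := Complex.reCLM.hasFDerivAt.comp_hasDerivWithinAt τ ((hu τ hτ).inner ℂ hMu)
      refine h.congr_deriv ?_
      have : (inner ℂ (u τ) (M (v τ)) : ℂ).re = (inner ℂ (v τ) (M (u τ)) : ℂ).re := by
        rw [← hMsymm, ← inner_conj_symm, Complex.conj_re]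
      simp only [Complex.reCLM_apply, Complex.add_re, this]
      ring
    have hE := fun τ hτ => (hasDerivWithinAt_energy hU (hp τ hτ) (hq τ hτ)).add (hpot τ hτ)
    have hfin := le_exp_mul_of_deriv_le (sq_nonneg c)
      (y := fun τ => ‖v τ‖ ^ 2 + ‖y τ‖ ^ 2 + (inner ℂ (u τ) (M (u τ)) : ℂ).re)
      (by have := hM (u 0); positivity) hE (fun τ hτ => ?_) ht
    · have hM0 : (inner ℂ (u 0) (M (u 0)) : ℂ).re ≤ ‖M‖ * ‖u₀‖ ^ 2 := by
        rw [hu0]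
        refine (Complex.re_le_norm _).trans ((norm_inner_le_norm _ _).trans ?_)
        have := mul_le_mul_of_nonneg_left (M.le_opNorm u₀) (norm_nonneg u₀)
        nlinarith
      have hMt := hM (u t)
      simp only [hv0, hy0] at hfin
      have := mul_le_mul_of_nonneg_left
        (add_le_add_left (add_le_add_right hM0 (‖u₁‖ ^ 2 + ‖A u₀‖ ^ 2)) (c ^ 2))
        (Real.exp_pos T).le
      linarith
    · have hBv := hB (v τ)
      have hMu := hM (u τ)
      have hFv : (inner ℂ (v τ) (F τ) : ℂ).re ≤ ‖v τ‖ * c :=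
        (Complex.re_le_norm _).trans ((norm_inner_le_norm _ _).trans
          (mul_le_mul_of_nonneg_left (hc τ hτ) (norm_nonneg _)))
      change 2 * (inner ℂ (v τ) (g τ) : ℂ).re + 2 * (inner ℂ (v τ) (M (u τ)) : ℂ).re ≤ _
      simp only [g, inner_sub_right, Complex.sub_re]
      nlinarith [sq_nonneg (‖v τ‖ - c), sq_nonneg ‖y τ‖]

end

end AbstractWave

namespace VeryWeak

open Filter Topology

variable {d : ℕ}

/-! ### Multiplication operators on `L²` -/

/-- Multiplication by an essentially bounded function, as a bounded operator on `L²`. -/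
noncomputable def mulOp (a : Sp d → ℂ) (ha : MemLp a ⊤ volume) : L2 d →L[ℂ] L2 d :=
  (ContinuousLinearMap.mul ℂ ℂ).holderL volume ⊤ 2 2 (ha.toLp a)

lemma coeFn_mulOp {a : Sp d → ℂ} (ha : MemLp a ⊤ volume) (f : L2 d) :
    mulOp a ha f =ᵐ[volume] fun x => a x * f x := by
  have h1 : mulOp a ha f =ᵐ[volume] fun x => (ha.toLp a) x * f x :=
    (ContinuousLinearMap.mul ℂ ℂ).coeFn_holder (ha.toLp a) f
  filter_upwards [h1, ha.coeFn_toLp] with x h1 h2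
  rw [h1, h2]

lemma norm_mulOp_le {a : Sp d → ℂ} (ha : MemLp a ⊤ volume) :
    ‖mulOp a ha‖ ≤ (eLpNorm a ⊤ volume).toReal := by
  refine ContinuousLinearMap.opNorm_le_bound _ ENNReal.toReal_nonneg fun f => ?_
  have h := (ContinuousLinearMap.mul ℂ ℂ).norm_holder_apply_apply_le (r := 2) (ha.toLp a) f
  rw [Lp.norm_toLp] at h
  refine h.trans ?_
  gcongr
  exact mul_le_of_le_one_left ENNReal.toReal_nonneg (ContinuousLinearMap.opNorm_mul_le ℂ ℂ)

lemma inner_mulOp_left {a b : Sp d → ℂ} (ha : MemLp a ⊤ volume) (hb : MemLp b ⊤ volume)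
    (hab : ∀ x, conj (a x) = b x) (f g : L2 d) :
    inner ℂ (mulOp a ha f) g = inner ℂ f (mulOp b hb g) := by
  rw [L2.inner_def, L2.inner_def]
  refine integral_congr_ae ?_
  filter_upwards [coeFn_mulOp ha f, coeFn_mulOp hb g] with x h1 h2
  rw [h1, h2, RCLike.inner_apply, RCLike.inner_apply, map_mul, hab]
  ring

lemma norm_sq_eq_integral (f : L2 d) : ‖f‖ ^ 2 = ∫ x, ‖f x‖ ^ 2 := by
  have h : ((‖f‖ ^ 2 : ℝ) : ℂ) = ((∫ x, ‖f x‖ ^ 2 : ℝ) : ℂ) := by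
    rw [← integral_complex_ofReal]
    push_cast
    have := inner_self_eq_norm_sq_to_K (𝕜 := ℂ) f
    rw [L2.inner_def] at this
    refine this.symm.trans (integral_congr_ae (ae_of_all _ fun x => ?_))
    exact inner_self_eq_norm_sq_to_K (𝕜 := ℂ) (f x)
  exact_mod_cast h

/-- Dominated convergence in `L²`. The representatives `G i` may be chosen freely, because along an
uncountable index set almost everywhere convergence is not invariant under a change of them. -/
lemma tendsto_L2_of_dominated {ι : Type*} {l : Filter ι} [l.IsCountablyGenerated]
    {g : ι → L2 d} {h : L2 d} {G : ι → Sp d → ℂ} {bound : Sp d → ℝ}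
    (hg : ∀ i, g i =ᵐ[volume] G i) (hb : MemLp bound 2 volume)
    (hGb : ∀ᶠ i in l, ∀ᵐ x, ‖G i x‖ ≤ bound x)
    (hlim : ∀ᵐ x, Tendsto (fun i => G i x) l (𝓝 (h x))) : Tendsto g l (𝓝 h) := by
  have hsq : ∀ i, ‖g i - h‖ ^ 2 = ∫ x, ‖G i x - h x‖ ^ 2 := fun i => by
    rw [norm_sq_eq_integral]
    refine integral_congr_ae ?_
    filter_upwards [hg i, Lp.coeFn_sub (g i) h] with x h1 h2
    rw [h2, Pi.sub_apply, h1]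
  have hint : Integrable (fun x => (bound x + ‖h x‖) ^ 2) volume :=
    (hb.add (Lp.memLp h).norm).integrable_sq
  have hI : Tendsto (fun i => ∫ x, ‖G i x - h x‖ ^ 2) l (𝓝 (∫ _ : Sp d, (0 : ℝ))) := by
    refine tendsto_integral_filter_of_dominated_convergence _ (Eventually.of_forall fun i => ?_)
      ?_ hint ?_
    · have hGm : AEStronglyMeasurable (G i) volume :=
        (Lp.aestronglyMeasurable (g i)).congr (hg i)
      exact (hGm.sub (Lp.aestronglyMeasurable h)).norm.pow 2
    · filter_upwards [hGb] with i hi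
      filter_upwards [hi] with x hx
      rw [Real.norm_of_nonneg (by positivity)]
      have := norm_sub_le (G i x) (h x)
      gcongr
      linarith
    · filter_upwards [hlim] with x hx
      have := ((hx.sub_const (h x)).norm).pow 2
      simpa using this
  rw [tendsto_iff_norm_sub_tendsto_zero]
  have := (hI.congr fun i => (hsq i).symm).sqrt
  simpa using this

/-! ### The wave group of the fractional Laplacian -/

lemma fracSymbol_nonneg (a : ℝ) (ξ : Sp d) : 0 ≤ fracSymbol a ξ := by
  unfold fracSymbol; positivity

lemma measurable_fracSymbol (a : ℝ) : Measurable (fracSymbol a : Sp d → ℝ) := by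
  unfold fracSymbol
  fun_prop

lemma fourier_fracLap {a : ℝ} {f : L2 d} (hf : MemFracLapDomain a f) :
    (𝓕 (fracLap a f) : L2 d) =ᵐ[volume] fun ξ => (fracSymbol a ξ : ℂ) * (𝓕 f : L2 d) ξ := by
  rw [fracLap, dif_pos hf, FourierTransform.fourier_fourierInv_eq]
  exact MemLp.coeFn_toLp hf

lemma memFracLapDomain_and_fracLap_eq {a : ℝ} {f y : L2 d}
    (h : (fun ξ => (fracSymbol a ξ : ℂ) * (𝓕 f : L2 d) ξ) =ᵐ[volume] (𝓕 y : L2 d)) :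
    MemFracLapDomain a f ∧ fracLap a f = y := by
  have hf : MemFracLapDomain a f := (Lp.memLp (𝓕 y : L2 d)).ae_eq h.symm
  refine ⟨hf, ?_⟩
  have h2 : (𝓕 (fracLap a f) : L2 d) = 𝓕 y := Lp.ext ((fourier_fracLap hf).trans h)
  have h3 := congrArg (fun g : L2 d => (𝓕⁻ g : L2 d)) h2
  simpa only [FourierTransform.fourierInv_fourier_eq] using h3

/-- The symbol `e^{i t σ}` of the group `e^{i t (-Δ)^a}`, where `σ` is the symbol of `(-Δ)^a`. -/
noncomputable def phase (a t : ℝ) (ξ : Sp d) : ℂ :=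
  Complex.exp (((t * fracSymbol a ξ : ℝ) : ℂ) * Complex.I)

lemma norm_phase (a t : ℝ) (ξ : Sp d) : ‖phase a t ξ‖ = 1 := Complex.norm_exp_ofReal_mul_I _

lemma phase_zero (a : ℝ) (ξ : Sp d) : phase a 0 ξ = 1 := by simp [phase]

lemma phase_mul_phase_neg (a t : ℝ) (ξ : Sp d) : phase a t ξ * phase a (-t) ξ = 1 := by
  rw [phase, phase, ← Complex.exp_add]
  simp

lemma conj_phase (a t : ℝ) (ξ : Sp d) : conj (phase a t ξ) = phase a (-t) ξ := by
  rw [phase, phase, ← Complex.exp_conj, map_mul, Complex.conj_ofReal, Complex.conj_I]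
  push_cast
  ring_nf

lemma measurable_phase (a t : ℝ) : Measurable (phase a t : Sp d → ℂ) := by
  have := measurable_fracSymbol (d := d) a
  unfold phase
  fun_prop

lemma memLp_phase (a t : ℝ) : MemLp (phase a t : Sp d → ℂ) ⊤ volume :=
  memLp_top_of_bound (measurable_phase a t).aestronglyMeasurable 1
    (ae_of_all _ fun ξ => (norm_phase a t ξ).le)

lemma hasDerivAt_phase (a t : ℝ) (ξ : Sp d) :
    HasDerivAt (fun τ => phase a τ ξ)
      (Complex.I * (phase a t ξ * (fracSymbol a ξ : ℂ))) t := by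
  have h1 : HasDerivAt (fun τ : ℝ => ((τ * fracSymbol a ξ : ℝ) : ℂ) * Complex.I)
      ((fracSymbol a ξ : ℂ) * Complex.I) t := by
    have := (((hasDerivAt_id t).mul_const (fracSymbol a ξ)).ofReal_comp).mul_const Complex.I
    simpa using this
  refine h1.cexp.congr_deriv ?_
  rw [phase]
  ring

lemma norm_slope_phase_le (a t τ : ℝ) (ξ : Sp d) :
    ‖slope (fun τ => phase a τ ξ) t τ‖ ≤ fracSymbol a ξ := by
  have h := Convex.norm_image_sub_le_of_norm_hasDerivWithin_le
    (f := fun τ => phase a τ ξ) (s := univ) (C := fracSymbol a ξ)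
    (fun τ _ => (hasDerivAt_phase a τ ξ).hasDerivWithinAt)
    (fun τ _ => by
      rw [norm_mul, norm_mul, Complex.norm_I, norm_phase, Complex.norm_real,
        Real.norm_of_nonneg (fracSymbol_nonneg a ξ), one_mul, one_mul])
    convex_univ (mem_univ t) (mem_univ τ)
  rw [slope_def_module, norm_smul, norm_inv]
  rcases eq_or_ne τ t with rfl | hne
  · simpa using fracSymbol_nonneg a ξ
  · rw [inv_mul_le_iff₀ (norm_pos_iff.2 (sub_ne_zero.2 hne)), mul_comm]
    exact h

lemma continuous_mulOp_phase (a : ℝ) (f : L2 d) :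
    Continuous fun t => mulOp (phase a t) (memLp_phase a t) f := by
  refine continuous_iff_continuousAt.2 fun t => ?_
  refine tendsto_L2_of_dominated (fun τ => coeFn_mulOp (memLp_phase a τ) f) (Lp.memLp f).norm
    (Eventually.of_forall fun τ => ae_of_all _ fun ξ => ?_) ?_
  · rw [norm_mul, norm_phase, one_mul]
  · filter_upwards [coeFn_mulOp (memLp_phase a t) f] with ξ h
    rw [h]
    exact (hasDerivAt_phase a t ξ).continuousAt.mul_const (f ξ)

lemma hasDerivAt_mulOp_phase (a : ℝ) {f g : L2 d}
    (hfg : g =ᵐ[volume] fun ξ => (fracSymbol a ξ : ℂ) * f ξ) (t : ℝ) :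
    HasDerivAt (fun τ => mulOp (phase a τ) (memLp_phase a τ) f)
      (Complex.I • mulOp (phase a t) (memLp_phase a t) g) t := by
  rw [hasDerivAt_iff_tendsto_slope]
  refine tendsto_L2_of_dominated
    (G := fun τ ξ => slope (fun τ => phase a τ ξ) t τ * f ξ)
    (fun τ => ?_) (Lp.memLp g).norm (Eventually.of_forall fun τ => ?_) ?_
  · rw [slope_def_module]
    filter_upwards [Lp.coeFn_smul (τ - t)⁻¹ (mulOp (phase a τ) (memLp_phase a τ) f
        - mulOp (phase a t) (memLp_phase a t) f),
      Lp.coeFn_sub (mulOp (phase a τ) (memLp_phase a τ) f)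
        (mulOp (phase a t) (memLp_phase a t) f),
      coeFn_mulOp (memLp_phase a τ) f, coeFn_mulOp (memLp_phase a t) f] with ξ h1 h2 h3 h4
    rw [h1, Pi.smul_apply, h2, Pi.sub_apply, h3, h4, slope_def_module, ← sub_mul, smul_mul_assoc]
  · filter_upwards [hfg] with ξ h
    rw [h, norm_mul, norm_mul, Complex.norm_real, Real.norm_of_nonneg (fracSymbol_nonneg a ξ)]
    gcongr
    exact norm_slope_phase_le a t τ ξ
  · filter_upwards [Lp.coeFn_smul Complex.I (mulOp (phase a t) (memLp_phase a t) g),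
      coeFn_mulOp (memLp_phase a t) g, hfg] with ξ h1 h2 h3
    rw [h1, Pi.smul_apply, h2, h3]
    have := (hasDerivAt_iff_tendsto_slope.1 (hasDerivAt_phase a t ξ)).mul_const (f ξ)
    convert this using 2
    rw [smul_eq_mul]
    ring

/-- The unitary group `e^{i t (-Δ)^a}` on `L²`. -/
noncomputable def waveGroup (a t : ℝ) : L2 d →L[ℂ] L2 d :=
  ((Lp.fourierTransformₗᵢ (Sp d) ℂ).symm.toContinuousLinearEquiv : L2 d →L[ℂ] L2 d) ∘L
    mulOp (phase a t) (memLp_phase a t) ∘L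
    ((Lp.fourierTransformₗᵢ (Sp d) ℂ).toContinuousLinearEquiv : L2 d →L[ℂ] L2 d)

lemma waveGroup_apply (a t : ℝ) (f : L2 d) :
    waveGroup a t f = 𝓕⁻ (mulOp (phase a t) (memLp_phase a t) (𝓕 f)) := rfl

lemma fourier_waveGroup (a t : ℝ) (f : L2 d) :
    (𝓕 (waveGroup a t f) : L2 d) = mulOp (phase a t) (memLp_phase a t) (𝓕 f) := by
  rw [waveGroup_apply, FourierTransform.fourier_fourierInv_eq]

/-- The multiplication operator `(-Δ)^a` contains its adjoint. The test functions are those with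
Fourier transform supported where the symbol is at most `n`, for every `n`. -/
lemma memFracLapDomain_of_inner_eq (a : ℝ) (u y : L2 d)
    (h : ∀ φ : L2 d, MemFracLapDomain a φ → inner ℂ (fracLap a φ) u = inner ℂ φ y) :
    MemFracLapDomain a u ∧ fracLap a u = y := by
  set S : ℕ → Set (Sp d) := fun n => {ξ | fracSymbol a ξ ≤ n}
  have hS : ∀ n, MeasurableSet (S n) := fun n =>
    measurableSet_le (measurable_fracSymbol a) measurable_const
  set c : ℕ → Sp d → ℂ := fun n => (S n).indicator 1
  set b : ℕ → Sp d → ℂ := fun n => (S n).indicator fun ξ => (fracSymbol a ξ : ℂ)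
  have hc : ∀ n, MemLp (c n) ⊤ volume := fun n =>
    memLp_top_of_bound ((measurable_one.indicator (hS n)).aestronglyMeasurable) 1
      (ae_of_all _ fun ξ => (norm_indicator_le_norm_self _ _).trans (by simp))
  have hb : ∀ n, MemLp (b n) ⊤ volume := fun n =>
    memLp_top_of_bound ((Complex.measurable_ofReal.comp (measurable_fracSymbol a)).indicator
      (hS n)).aestronglyMeasurable n (ae_of_all _ fun ξ => by
        by_cases hξ : ξ ∈ S n
        · simp only [b, indicator_of_mem hξ, Complex.norm_real,
            Real.norm_of_nonneg (fracSymbol_nonneg a ξ)]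
          exact hξ
        · simp [b, indicator_of_notMem hξ])
  have hcc : ∀ n ξ, conj (c n ξ) = c n ξ := fun n ξ => by
    by_cases hξ : ξ ∈ S n
    · simp [c, indicator_of_mem hξ]
    · simp [c, indicator_of_notMem hξ]
  have hbc : ∀ n ξ, conj (b n ξ) = b n ξ := fun n ξ => by
    by_cases hξ : ξ ∈ S n
    · simp [b, indicator_of_mem hξ]
    · simp [b, indicator_of_notMem hξ]
  have key : ∀ n, mulOp (b n) (hb n) (𝓕 u) = mulOp (c n) (hc n) (𝓕 y) := fun n => by
    refine ext_inner_left ℂ fun ψ => ?_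
    obtain ⟨h1, h2⟩ := memFracLapDomain_and_fracLap_eq (a := a)
      (f := (𝓕⁻ (mulOp (c n) (hc n) ψ) : L2 d)) (y := (𝓕⁻ (mulOp (b n) (hb n) ψ) : L2 d)) (by
        rw [FourierTransform.fourier_fourierInv_eq, FourierTransform.fourier_fourierInv_eq]
        filter_upwards [coeFn_mulOp (hc n) ψ, coeFn_mulOp (hb n) ψ] with ξ e1 e2
        rw [e1, e2]
        by_cases hξ : ξ ∈ S n
        · simp [b, c, indicator_of_mem hξ]
        · simp [b, c, indicator_of_notMem hξ])
    have h3 := h _ h1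
    rw [h2, ← Lp.inner_fourier_eq, ← Lp.inner_fourier_eq (𝓕⁻ (mulOp (c n) (hc n) ψ) : L2 d),
      FourierTransform.fourier_fourierInv_eq, FourierTransform.fourier_fourierInv_eq,
      inner_mulOp_left (hb n) (hb n) (hbc n), inner_mulOp_left (hc n) (hc n) (hcc n)] at h3
    exact h3
  refine memFracLapDomain_and_fracLap_eq ?_
  have h1 : ∀ᵐ ξ, ∀ n, b n ξ * (𝓕 u : L2 d) ξ = c n ξ * (𝓕 y : L2 d) ξ := by
    refine ae_all_iff.2 fun n => ?_
    filter_upwards [coeFn_mulOp (hb n) (𝓕 u), coeFn_mulOp (hc n) (𝓕 y)] with ξ e1 e2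
    rw [← e1, ← e2, key n]
  filter_upwards [h1] with ξ hξ
  obtain ⟨n, hn⟩ := exists_nat_ge (fracSymbol a ξ)
  have hmem : ξ ∈ S n := hn
  simpa [b, c, indicator_of_mem hmem] using hξ n

/-- Together with symmetry, `memFracLapDomain_of_inner_eq` says that `(-Δ)^a` is self-adjoint;
its group is `e^{i t (-Δ)^a}`. -/
theorem isUnitaryGroup_waveGroup (a : ℝ) :
    IsUnitaryGroup (waveGroup a : ℝ → L2 d →L[ℂ] L2 d) {f | MemFracLapDomain a f} (fracLap a) where
  zero_apply f := by
    rw [waveGroup_apply]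
    have : mulOp (phase a 0) (memLp_phase a 0) (𝓕 f : L2 d) = 𝓕 f := Lp.ext (by
      filter_upwards [coeFn_mulOp (memLp_phase a 0) (𝓕 f : L2 d)] with ξ h
      rw [h, phase_zero, one_mul])
    rw [this, FourierTransform.fourierInv_fourier_eq]
  apply_neg_apply t f := by
    rw [waveGroup_apply, fourier_waveGroup]
    have : mulOp (phase a t) (memLp_phase a t)
        (mulOp (phase a (-t)) (memLp_phase a (-t)) (𝓕 f : L2 d)) = 𝓕 f := Lp.ext (by
      filter_upwards [coeFn_mulOp (memLp_phase a t)
        (mulOp (phase a (-t)) (memLp_phase a (-t)) (𝓕 f : L2 d)),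
        coeFn_mulOp (memLp_phase a (-t)) (𝓕 f : L2 d)] with ξ h1 h2
      rw [h1, h2, ← mul_assoc, phase_mul_phase_neg, one_mul])
    rw [this, FourierTransform.fourierInv_fourier_eq]
  norm_apply t f := by
    rw [← Lp.norm_fourier_eq, fourier_waveGroup, ← Lp.norm_fourier_eq f]
    rw [Lp.norm_def, Lp.norm_def]
    refine congrArg _ (eLpNorm_congr_norm_ae ?_)
    filter_upwards [coeFn_mulOp (memLp_phase a t) (𝓕 f : L2 d)] with ξ h
    rw [h, norm_mul, norm_phase, one_mul]
  inner_apply t f g := by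
    rw [← Lp.inner_fourier_eq, ← Lp.inner_fourier_eq (waveGroup a (-t) f), fourier_waveGroup,
      fourier_waveGroup]
    exact (inner_mulOp_left _ _ (fun ξ => by rw [conj_phase, neg_neg]) _ _).symm
  continuous f :=
    (Lp.fourierTransformₗᵢ (Sp d) ℂ).symm.continuous.comp (continuous_mulOp_phase a (𝓕 f))
  hasDerivAt φ hφ t := by
    have h := hasDerivAt_mulOp_phase a (fourier_fracLap hφ) t
    have h2 := (((Lp.fourierTransformₗᵢ (Sp d) ℂ).symm.toContinuousLinearEquiv :
      L2 d →L[ℂ] L2 d).restrictScalars ℝ).hasFDerivAt.comp_hasDerivAt t h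
    refine h2.congr_deriv ?_
    exact map_smul (Lp.fourierTransformₗᵢ (Sp d) ℂ).symm _ _
  symm φ hφ ψ hψ := by
    rw [← Lp.inner_fourier_eq, ← Lp.inner_fourier_eq φ, L2.inner_def, L2.inner_def]
    refine integral_congr_ae ?_
    filter_upwards [fourier_fracLap hφ, fourier_fracLap hψ] with ξ h1 h2
    rw [h1, h2, RCLike.inner_apply, RCLike.inner_apply, map_mul, Complex.conj_ofReal]
    ring
  eq_of_inner_eq := memFracLapDomain_of_inner_eq a

end VeryWeak

namespace VeryWeak

variable {d : ℕ}

/-! ### The Cauchy problem with bounded coefficients -/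

lemma re_inner_mulOp_nonneg {m : Sp d → ℝ} (hm : MemLp (fun x => (m x : ℂ)) ⊤ volume)
    (h0 : ∀ x, 0 ≤ m x) (f : L2 d) : 0 ≤ (inner ℂ f (mulOp _ hm f)).re := by
  have h : inner ℂ f (mulOp _ hm f) = ((∫ x, m x * ‖f x‖ ^ 2 : ℝ) : ℂ) := by
    rw [L2.inner_def, ← integral_complex_ofReal]
    refine integral_congr_ae ?_
    filter_upwards [coeFn_mulOp hm f] with x hx
    rw [hx, RCLike.inner_apply, mul_assoc, RCLike.mul_conj]
    push_cast
    rfl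
  rw [h, Complex.ofReal_re]
  exact integral_nonneg fun x => mul_nonneg (h0 x) (by positivity)

/-- The Cauchy problem with bounded non-negative coefficients has a solution, and the solution is
bounded by the data with a constant that is affine in the norm of the mass term and independent of
the dissipation. -/
theorem exists_isSolution {s T : ℝ} (hT : 0 < T) {m b : Sp d → ℝ} {f : ℝ → Sp d → ℂ}
    {u₀ u₁ : Sp d → ℂ} (hm : MemLp m ⊤ volume) (hm0 : ∀ x, 0 ≤ m x)
    (hb : MemLp b ⊤ volume) (hb0 : ∀ x, 0 ≤ b x)
    {F : ℝ → L2 d} (hF : ContinuousOn F (Icc 0 T)) (hFf : ∀ t ∈ Icc 0 T, F t =ᵐ[volume] f t)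
    {c : ℝ} (hc : ∀ t ∈ Icc 0 T, ‖F t‖ ≤ c)
    {w₀ w₁ : L2 d} (hw₀ : w₀ =ᵐ[volume] u₀) (hw₀s : MemHs s w₀) (hw₁ : w₁ =ᵐ[volume] u₁) :
    ∃ u : ℝ → L2 d, IsSolution T s m b f u₀ u₁ u ∧
      ∀ t ∈ Icc 0 T, ‖u t‖ + ‖fracLap (s / 2) (u t)‖ + ‖dt T u t‖ ≤
        (1 + (T + 2) * Real.exp T)
          * ((1 + (eLpNorm m ⊤ volume).toReal) * hsNorm s w₀ + ‖w₁‖ + c) := by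
  have hm' : MemLp (fun x => (m x : ℂ)) ⊤ volume := hm.ofReal
  have hb' : MemLp (fun x => (b x : ℂ)) ⊤ volume := hb.ofReal
  have h0 : (0 : ℝ) ∈ Icc 0 T := ⟨le_rfl, hT.le⟩
  have hc0 : 0 ≤ c := (norm_nonneg _).trans (hc 0 h0)
  obtain ⟨u, v, hu0, hv0, hu, hvc, huD, hAu, hweak, hE⟩ :=
    (isUnitaryGroup_waveGroup (d := d) (s / 2)).exists_wave_solution (mulOp _ hm') (mulOp _ hb')
      (inner_mulOp_left hm' hm' fun x => Complex.conj_ofReal _)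
      (re_inner_mulOp_nonneg hm' hm0) (re_inner_mulOp_nonneg hb' hb0) hT.le hF hc hw₀s w₁
  have hdt : ∀ t ∈ Icc 0 T, dt T u t = v t := fun t ht =>
    (hu t ht).derivWithin (uniqueDiffOn_Icc hT t ht)
  refine ⟨u, ⟨⟨huD, hAu, ?_⟩, ?_, ?_, fun φ hφ t ht => ?_⟩, fun t ht => ?_⟩
  · rw [contDiffOn_one_iff_derivWithin (uniqueDiffOn_Icc hT)]
    exact ⟨fun t ht => (hu t ht).differentiableWithinAt, hvc.congr hdt⟩
  · rw [hu0]; exact hw₀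
  · rw [hdt 0 h0, hv0]; exact hw₁
  · have hint : inner ℂ φ (F t - mulOp _ hm' (u t) - mulOp _ hb' (v t))
        = ∫ x, conj (φ x) * (f t x - (m x : ℂ) * u t x - (b x : ℂ) * dt T u t x) := by
      rw [L2.inner_def]
      refine integral_congr_ae ?_
      filter_upwards [Lp.coeFn_sub (F t - mulOp _ hm' (u t)) (mulOp _ hb' (v t)),
        Lp.coeFn_sub (F t) (mulOp _ hm' (u t)), coeFn_mulOp hm' (u t), coeFn_mulOp hb' (v t),
        hFf t ht] with x e1 e2 e3 e4 e5
      rw [e1, Pi.sub_apply, e2, Pi.sub_apply, e3, e4, e5, hdt t ht, RCLike.inner_apply, mul_comm]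
    rw [← hint]
    exact (hweak φ hφ t ht).congr (fun τ hτ => by rw [hdt τ hτ]) (by rw [hdt t ht])
  · set μ := (eLpNorm m ⊤ volume).toReal
    have hμ : ‖mulOp _ hm'‖ ≤ μ := by
      have he : eLpNorm (fun x => (m x : ℂ)) ⊤ volume = eLpNorm m ⊤ volume :=
        eLpNorm_congr_norm_ae (ae_of_all _ fun x => Complex.norm_real _)
      have := norm_mulOp_le hm'
      rwa [he] at this
    have hμ0 : 0 ≤ μ := ENNReal.toReal_nonneg
    set Q := (1 + μ) * hsNorm s w₀ + ‖w₁‖ + c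
    have ha := norm_nonneg w₀
    have ha' := norm_nonneg (fracLap (s / 2) w₀)
    have hh0 : 0 ≤ hsNorm s w₀ := add_nonneg ha ha'
    have hw1 := norm_nonneg w₁
    have hp0 : 0 ≤ (1 + μ) * hsNorm s w₀ := by positivity
    have hQ0 : 0 ≤ Q := by positivity
    have hhQ : hsNorm s w₀ ≤ Q := by
      have : 0 ≤ μ * hsNorm s w₀ := by positivity
      simp only [Q]
      linarith
    have hsum : ‖w₁‖ ^ 2 + ‖fracLap (s / 2) w₀‖ ^ 2 + ‖mulOp _ hm'‖ * ‖w₀‖ ^ 2 + c ^ 2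
        ≤ Q ^ 2 := by
      have e1 : ‖mulOp _ hm'‖ * ‖w₀‖ ^ 2 ≤ μ * hsNorm s w₀ ^ 2 := by
        gcongr
        exact le_add_of_nonneg_right ha'
      have e2 : ‖fracLap (s / 2) w₀‖ ^ 2 ≤ hsNorm s w₀ ^ 2 := by
        gcongr
        exact le_add_of_nonneg_left ha
      have e3 : (1 + μ) * hsNorm s w₀ ^ 2 ≤ ((1 + μ) * hsNorm s w₀) ^ 2 := by
        rw [mul_pow]
        gcongr
        nlinarith
      have e4 := mul_nonneg hp0 hw1
      have e5 := mul_nonneg hp0 hc0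
      have e6 := mul_nonneg hw1 hc0
      simp only [Q]
      nlinarith
    have hexp : 1 ≤ Real.exp T := Real.one_le_exp hT.le
    have hbd : ∀ τ ∈ Icc 0 T, ‖v τ‖ ≤ Real.exp T * Q ∧
        ‖fracLap (s / 2) (u τ)‖ ≤ Real.exp T * Q := fun τ hτ => by
      have h1 : ‖v τ‖ ^ 2 + ‖fracLap (s / 2) (u τ)‖ ^ 2 ≤ (Real.exp T * Q) ^ 2 := by
        refine (hE τ hτ).trans ((mul_le_mul_of_nonneg_left hsum (Real.exp_pos T).le).trans ?_)
        rw [mul_pow]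
        gcongr
        nlinarith
      have hX : 0 ≤ Real.exp T * Q := by positivity
      constructor <;> refine le_of_sq_le_sq ?_ hX
      · nlinarith [sq_nonneg ‖fracLap (s / 2) (u τ)‖]
      · nlinarith [sq_nonneg ‖v τ‖]
    have hut : ‖u t‖ ≤ Q + T * (Real.exp T * Q) := by
      have h1 := norm_image_sub_le_of_norm_deriv_le_segment' hu
        (fun τ hτ => (hbd τ (Ico_subset_Icc_self hτ)).1) t ht
      have h2 := norm_le_norm_add_norm_sub' (u t) (u 0)
      have h3 : ‖u 0‖ ≤ hsNorm s w₀ := by rw [hu0]; exact le_add_of_nonneg_right ha'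
      have h4 : Real.exp T * Q * (t - 0) ≤ T * (Real.exp T * Q) := by
        rw [sub_zero, mul_comm]
        gcongr
        exact ht.2
      linarith
    rw [hdt t ht]
    have := hbd t ht
    linarith [this.1, this.2]

end VeryWeak

/-- The solutions for the given regularisations form the required net: each bound of the data by a
power of `1/ε` passes to the solutions, because the estimate of `VeryWeak.exists_isSolution` is
polynomial in the norms of the coefficients and data. -/
theorem theorem4p8 (d : ℕ) (s T : ℝ) (hs : 0 < s) (hT : 0 < T)
    (m b : 𝓓'((⊤ : Opens (VeryWeak.Sp d)), ℝ))
    (f : ℝ → 𝓓'((⊤ : Opens (VeryWeak.Sp d)), ℂ))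
    (u₀ u₁ : 𝓓'((⊤ : Opens (VeryWeak.Sp d)), ℂ))
    (hreg : ∃ (mε bε : ℝ → VeryWeak.Sp d → ℝ) (fε : ℝ → ℝ → VeryWeak.Sp d → ℂ)
      (u₀ε u₁ε : ℝ → VeryWeak.Sp d → ℂ),
      VeryWeak.AdmissibleRegularisation T s m b f u₀ u₁ mε bε fε u₀ε u₁ε) :
    ∃ u : ℝ → ℝ → VeryWeak.L2 d, VeryWeak.IsVeryWeakSolution T s m b f u₀ u₁ u := by
  obtain ⟨mε, bε, fε, u₀ε, u₁ε, hadm⟩ := hreg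
  obtain ⟨⟨-, ⟨N₁, hN₁, C₁, hC₁, hm⟩, hm0⟩, ⟨-, ⟨_, _, _, _, hb⟩, hb0⟩,
    ⟨-, N₂, -, C₂, hC₂, hf⟩, ⟨-, N₃, -, C₃, hC₃, hu₀⟩, ⟨-, N₄, -, C₄, hC₄, hu₁⟩⟩ := id hadm
  have hsol : ∀ ε ∈ Ioc (0 : ℝ) 1, ∃ u : ℝ → VeryWeak.L2 d,
      VeryWeak.IsSolution T s (mε ε) (bε ε) (fε ε) (u₀ε ε) (u₁ε ε) u ∧
      ∀ t ∈ Icc 0 T, ‖u t‖ + ‖VeryWeak.fracLap (s / 2) (u t)‖ + ‖VeryWeak.dt T u t‖ ≤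
        (1 + (T + 2) * Real.exp T) * (C₃ + C₁ * C₃ + C₄ + C₂) / ε ^ (N₁ + N₂ + N₃ + N₄) := by
    intro ε hε
    obtain ⟨F, hF, hFf⟩ := hf ε hε
    obtain ⟨w₀, hw₀, hw₀s, hw₀n⟩ := hu₀ ε hε
    obtain ⟨hu₁m, hu₁n⟩ := hu₁ ε hε
    obtain ⟨u, hu, hun⟩ := VeryWeak.exists_isSolution hT (hm ε hε).1 (hm0 ε hε) (hb ε hε).1
      (hb0 ε hε) hF (fun t ht => (hFf t ht).1) (fun t ht => (hFf t ht).2) hw₀ hw₀s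
      hu₁m.coeFn_toLp
    refine ⟨u, hu, fun t ht => (hun t ht).trans ?_⟩
    have hpos : 0 < ε := hε.1
    have hmn : (eLpNorm (mε ε) ⊤ volume).toReal ≤ C₁ / ε ^ N₁ :=
      ENNReal.toReal_le_of_le_ofReal (by positivity) (hm ε hε).2
    have hu₁n' : ‖hu₁m.toLp (u₁ε ε)‖ ≤ C₄ / ε ^ N₄ := by
      rw [Lp.norm_toLp]
      exact ENNReal.toReal_le_of_le_ofReal (by positivity) hu₁n
    have hpow : ∀ {C : ℝ} {n k : ℕ}, 0 < C → n ≤ k → C / ε ^ n ≤ C / ε ^ k :=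
      fun hC hnk => div_le_div_of_nonneg_left hC.le (by positivity)
        (pow_le_pow_of_le_one hpos.le hε.2 hnk)
    rw [mul_div_assoc]
    have hT2 : 0 ≤ 1 + (T + 2) * Real.exp T := by positivity
    refine mul_le_mul_of_nonneg_left ?_ hT2
    have hh0 : 0 ≤ VeryWeak.hsNorm s w₀ := add_nonneg (norm_nonneg _) (norm_nonneg _)
    calc (1 + (eLpNorm (mε ε) ⊤ volume).toReal) * VeryWeak.hsNorm s w₀
          + ‖hu₁m.toLp (u₁ε ε)‖ + C₂ / ε ^ N₂
        ≤ (1 + C₁ / ε ^ N₁) * (C₃ / ε ^ N₃) + C₄ / ε ^ N₄ + C₂ / ε ^ N₂ := by gcongr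
      _ = C₃ / ε ^ N₃ + C₁ * C₃ / ε ^ (N₁ + N₃) + C₄ / ε ^ N₄ + C₂ / ε ^ N₂ := by
        rw [pow_add]; field_simp
      _ ≤ C₃ / ε ^ (N₁ + N₂ + N₃ + N₄) + C₁ * C₃ / ε ^ (N₁ + N₂ + N₃ + N₄)
          + C₄ / ε ^ (N₁ + N₂ + N₃ + N₄) + C₂ / ε ^ (N₁ + N₂ + N₃ + N₄) :=
        add_le_add (add_le_add (add_le_add (hpow hC₃ (by omega))
          (hpow (mul_pos hC₁ hC₃) (by omega))) (hpow hC₄ (by omega))) (hpow hC₂ (by omega))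
      _ = (C₃ + C₁ * C₃ + C₄ + C₂) / ε ^ (N₁ + N₂ + N₃ + N₄) := by ring
  choose! u hu hun using hsol
  refine ⟨u, mε, bε, fε, u₀ε, u₁ε, hadm, hu, fun ε hε => (hu ε hε).1,
    N₁ + N₂ + N₃ + N₄, by omega, _, ?_, hun⟩
  positivity
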